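/- Let $M_{2,4}(\mathbb{R})$ be the space of real $2\times4$ matrices of rank $2$, let $G_{2,4}(\mathbb{R})$ be the Grassmannian of two-dimensional subspaces of $\mathbb{R}^4$, let $O(1)=\{1,-1\}$, and let $\pi(B)\in G_{2,4}(\mathbb{R})$ be the plane spanned by the rows of $B\in M_{2,4}(\mathbb{R})$. Put $\widetilde G:=M_{2,4}(\mathbb{R})/(\mathbb{R}^+\times SL(2,\mathbb{R}))$, where $(r,g)$ acts by $B\mapsto rgB$, and write $[B]$ for the class of $B$ in $\widetilde G$; $O(1)$ acts on $\widetilde G$ by $\varepsilon[B]=[\mathrm{diag}(\varepsilon,1)B]$. For $X,Y\in\mathbb{R}^4$ let $(X;Y)$ be the matrix with rows $X,Y$. Write $W_i=(\lambda_{i0},\lambda_{i1},\mu_i^{0'},\mu_i^{1'})\in\mathbb{R}^4$ and $\langle ij\rangle=\lambda_{i0}\lambda_{j1}-\lambda_{i1}\lambda_{j0}$. For linearly independent $W_2,W_3\in\mathbb{R}^4$, that is, $B=(W_2;W_3)\in M_{2,4}(\mathbb{R})$, define $$\delta^{(2)}(W_1,W_2,W_3)=\int_{\mathbb{R}^2}\frac{ds}{s}\frac{dt}{t}\,\mathrm{sgn}(s)\,\mathrm{sgn}(t)\,\delta^{(4)}(W_1-sW_2-tW_3),\qquad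 \tilde\delta^{(2)}(W_1,W_2,W_3)=\int_{\mathbb{R}^2}\frac{ds}{s}\frac{dt}{t}\,\delta^{(4)}(W_1-sW_2-tW_3)$$ as generalized functions of $W_1$ on the open set where $W_1,W_2$ are linearly independent and $W_3,W_1$ are linearly independent; they are paired with smooth functions $\varphi$ compactly supported in that set, for which the integrals converge absolutely. Then: 1. If $\langle23\rangle\neq0$, then $\delta^{(2)}(W_1,W_2,W_3)=\mathrm{sgn}(\langle31\rangle\langle12\rangle)\,\tilde\delta^{(2)}(W_1,W_2,W_3)$. 2. (Domains.) (a) Both $\delta^{(2)}$ and $\tilde\delta^{(2)}$ vanish on every test function that is zero wherever $\pi(W_3;W_1)=\pi(W_1;W_2)=\pi(W_2;W_3)$. For $\varepsilon\in O(1)$, if $\varphi(W_1)=0$ whenever $\pi(W_3;W_1)=\pi(W_1;W_2)$ but $[(W_3;W_1)]\neq\varepsilon[(W_1;W_2)]$, then the pairings satisfy $\tilde\delta^{(2)}(\varphi)=\varepsilon\,\delta^{(2)}(\varphi)$. In particular $\tilde\delta^{(2)}$ equals $\delta^{(2)}$ where $(W_3;W_1)$ and $(W_1;W_2)$ are the same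 point of $\widetilde G$. (b) Let $A\in M_{2,4}(\mathbb{R})$, $(W_2;W_3)=cA$ with $c$ a $2\times2$ matrix with rows $c_2,c_3$, and let $K_c(x)=\dfrac{[c_2c_3]}{[c_3x][xc_2]}$ for $x\in\mathbb{R}^2$, with $[uv]=u_0v_1-u_1v_0$. For every such frame $A$ of the plane, $\delta^{(2)}(\varphi)=\int_{\mathbb{R}^2}|K_c(x)|\,\varphi(xA)\,d^2x$. If moreover $[A]=\varepsilon[(W_2;W_3)]$ with $\varepsilon\in O(1)$, then $\tilde\delta^{(2)}(\varphi)=\varepsilon\int_{\mathbb{R}^2}K_c(x)\,\varphi(xA)\,d^2x$. (c) $\delta^{(2)}$ depends on $(W_2,W_3)$ only through the point $\pi(W_2;W_3)$ of $G_{2,4}(\mathbb{R})$ and the points of $\mathbb{RP}^3$ given by $W_2$ and $W_3$. $\tilde\delta^{(2)}$ depends on $(W_2,W_3)$ only through the point $[(W_2;W_3)]$ of $\widetilde G$ and these two points of $\mathbb{RP}^3$; as a function on $\widetilde G$ it is multiplied by $\varepsilon$ under $\varepsilon\in O(1)$, and it does not factor through $G_{2,4}(\mathbb{R})$ and these two points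 of $\mathbb{RP}^3$. 3. (The spaces.) The map $\pi$ induces a homeomorphism $M_{2,4}(\mathbb{R})/GL(2,\mathbb{R})\cong G_{2,4}(\mathbb{R})$. The group $O(1)$ acts freely and continuously on $\widetilde G$, and $\pi$ induces a homeomorphism $\widetilde G/O(1)\cong G_{2,4}(\mathbb{R})$. Moreover $\widetilde G\approx G_{2,4}(\mathbb{R})\times O(1)$ in the following sense: for all $i\neq j$ there is an $O(1)$-equivariant bijection $\widetilde G\to G_{2,4}(\mathbb{R})\times O(1)$ with first component $[B]\mapsto\pi(B)$, which over the open set of planes where the minor of columns $i,j$ is nonzero is a homeomorphism, with second component the sign of that minor of $B$. -/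

import Mathlib

open MeasureTheory
open scoped ContDiff

noncomputable section

namespace CollinearDelta

/-- Homogeneous coordinates `(λ₀, λ₁, μ⁰, μ¹)` of a real twistor. -/
abbrev Twistor : Type := Fin 4 → ℝ

/-- The bracket `⟨X Y⟩ = λ_{X,0} λ_{Y,1} - λ_{X,1} λ_{Y,0}`. -/
def bracket (X Y : Twistor) : ℝ := X 0 * Y 1 - X 1 * Y 0

/-- The `2 × 4` matrix with rows `X` and `Y`. -/
def rows (X Y : Twistor) : Matrix (Fin 2) (Fin 4) ℝ := Matrix.of ![X, Y]

/-! ### Frames, the Grassmannian, and the two quotients -/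

/-- `M_{2,4}(ℝ)`: real `2 × 4` matrices of rank two, with the subspace topology. -/
abbrev M24 : Type := {B : Matrix (Fin 2) (Fin 4) ℝ // B.rank = 2}

/-- The minor of `B` on the columns `i, j`. -/
def minor (B : M24) (i j : Fin 4) : ℝ := B.1 0 i * B.1 1 j - B.1 0 j * B.1 1 i

/-- The real Grassmannian: the set of two-dimensional linear subspaces of `ℝ⁴`. -/
def Gr24 : Type := {P : Submodule ℝ Twistor // Module.finrank ℝ P = 2}

/-- The plane spanned by the rows of a frame. -/
def rowPlane (B : M24) : Gr24 :=
  ⟨Submodule.span ℝ (Set.range B.1.row), by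
    rw [← Matrix.rank_eq_finrank_span_row]; exact B.2⟩

/-- The usual topology of the Grassmannian: the finest one for which the plane spanned by a frame
depends continuously on the frame. -/
instance : TopologicalSpace Gr24 := TopologicalSpace.coinduced rowPlane inferInstance

/-- Left multiplication of a frame by an invertible matrix. -/
def frameMul (g : Matrix (Fin 2) (Fin 2) ℝ) (hg : IsUnit g.det) (B : M24) : M24 :=
  ⟨g * B.1, by rw [Matrix.rank_mul_eq_right_of_isUnit_det g B.1 hg]; exact B.2⟩

/-- Two frames in the same orbit of `GL(2, ℝ)`. -/
def glSetoid : Setoid M24 where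
  r A B := ∃ g : GL (Fin 2) ℝ, B.1 = (g : Matrix (Fin 2) (Fin 2) ℝ) * A.1
  iseqv :=
    { refl := fun A => ⟨1, by simp⟩
      symm := by
        rintro A B ⟨g, h⟩
        refine ⟨g⁻¹, ?_⟩
        rw [h, ← Matrix.mul_assoc, ← Units.val_mul]
        simp
      trans := by
        rintro A B C ⟨g, h⟩ ⟨k, h'⟩
        exact ⟨k * g, by rw [h', h, Units.val_mul, Matrix.mul_assoc]⟩ }

/-- Two frames in the same orbit of `ℝ⁺ × SL(2, ℝ)`, where `(r, g)` acts by `B ↦ r g B`. -/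
def posSetoid : Setoid M24 where
  r A B := ∃ r : ℝ, 0 < r ∧ ∃ g : Matrix.SpecialLinearGroup (Fin 2) ℝ,
    B.1 = r • ((g : Matrix (Fin 2) (Fin 2) ℝ) * A.1)
  iseqv :=
    { refl := fun A => ⟨1, one_pos, 1, by simp⟩
      symm := by
        rintro A B ⟨r, hr, g, h⟩
        refine ⟨r⁻¹, inv_pos.2 hr, g⁻¹, ?_⟩
        rw [h, Matrix.mul_smul, smul_smul, inv_mul_cancel₀ hr.ne', one_smul, ← Matrix.mul_assoc,
          ← Matrix.SpecialLinearGroup.coe_mul]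
        simp
      trans := by
        rintro A B C ⟨r, hr, g, h⟩ ⟨r', hr', k, h'⟩
        refine ⟨r' * r, mul_pos hr' hr, k * g, ?_⟩
        rw [h', h, Matrix.mul_smul, smul_smul, Matrix.SpecialLinearGroup.coe_mul,
          Matrix.mul_assoc] }

/-- `M_{2,4}(ℝ) / GL(2, ℝ)`, with the quotient topology. -/
abbrev FrameModGL : Type := Quotient glSetoid

/-- `M_{2,4}(ℝ) / (ℝ⁺ × SL(2, ℝ))`, with the quotient topology. -/
abbrev OrientedGr24 : Type := Quotient posSetoid

/-- The class of a frame in `M_{2,4}(ℝ) / (ℝ⁺ × SL(2, ℝ))`. -/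
def orientedPlane (B : M24) : OrientedGr24 := Quotient.mk posSetoid B

/-- The matrix `diag(ε, 1)` for `ε ∈ O(1) = {1, -1}`. -/
def signMatrix (ε : ℤˣ) : Matrix (Fin 2) (Fin 2) ℝ := Matrix.diagonal ![((ε : ℤ) : ℝ), 1]

theorem signMatrix_one : signMatrix 1 = 1 := by
  ext i j; fin_cases i <;> fin_cases j <;> simp [signMatrix]

theorem signMatrix_mul (ε η : ℤˣ) : signMatrix (ε * η) = signMatrix ε * signMatrix η := by
  ext i j; fin_cases i <;> fin_cases j <;> simp [signMatrix]

theorem signMatrix_sq (ε : ℤˣ) : signMatrix ε * signMatrix ε = 1 := by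
  rw [← signMatrix_mul, Int.units_mul_self, signMatrix_one]

theorem isUnit_det_signMatrix (ε : ℤˣ) : IsUnit (signMatrix ε).det :=
  (Matrix.isUnit_iff_isUnit_det _).1 (IsUnit.of_mul_eq_one _ (signMatrix_sq ε))

/-- The action of `O(1) = {1, -1}` on `M_{2,4}(ℝ) / (ℝ⁺ × SL(2, ℝ))`: the element `-1` sends the
class of a frame to the class of the frame whose first row has been negated. -/
instance : MulAction ℤˣ OrientedGr24 where
  smul ε := Quotient.map (frameMul (signMatrix ε) (isUnit_det_signMatrix ε)) (by
    rintro A B ⟨r, hr, g, h⟩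
    refine ⟨r, hr, ⟨signMatrix ε * (g : Matrix (Fin 2) (Fin 2) ℝ) * signMatrix ε, ?_⟩, ?_⟩
    · rw [Matrix.det_mul, Matrix.det_mul, g.2, mul_one, ← Matrix.det_mul, signMatrix_sq,
        Matrix.det_one]
    · simp only [frameMul]
      rw [h, Matrix.mul_smul, Matrix.mul_assoc (signMatrix ε * _) (signMatrix ε),
        ← Matrix.mul_assoc (signMatrix ε) (signMatrix ε), signMatrix_sq, Matrix.one_mul,
        Matrix.mul_assoc])
  one_smul x := by
    induction x using Quotient.inductionOn with
    | h B =>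
      refine congrArg (Quotient.mk posSetoid) (Subtype.ext ?_)
      simp [frameMul, signMatrix_one]
  mul_smul ε η x := by
    induction x using Quotient.inductionOn with
    | h B =>
      refine congrArg (Quotient.mk posSetoid) (Subtype.ext ?_)
      simp [frameMul, signMatrix_mul, Matrix.mul_assoc]

theorem row_ne_zero (B : M24) (i : Fin 2) : B.1 i ≠ 0 := by
  have h : LinearIndependent ℝ B.1.row := by
    rw [linearIndependent_iff_card_eq_finrank_span, Set.finrank,
      ← Matrix.rank_eq_finrank_span_row, B.2]
    simp
  exact h.ne_zero i

/-- The point of the real projective twistor space given by the `i`-th row of a frame. -/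
def rowPoint (B : M24) (i : Fin 2) : Projectivization ℝ Twistor :=
  Projectivization.mk ℝ (B.1 i) (row_ne_zero B i)

/-! ### The collinear delta functions

A frame `B` has rows `W₂ = B 0` and `W₃ = B 1`. For fixed `B` the delta functions are generalized
functions of the remaining variable `W₁`, on the open set where `W₁` is linearly independent of
`W₃` and of `W₂`. -/

/-- The twistors `W₁` for which `(W₃; W₁)` and `(W₁; W₂)` have rank two. -/
def admissible (B : M24) : Set Twistor :=
  {W | (rows (B.1 1) W).rank = 2 ∧ (rows W (B.1 0)).rank = 2}

/-- The frame `(W₃; W₁)`. -/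
def frame31 (B : M24) (W : admissible B) : M24 := ⟨rows (B.1 1) W.1, W.2.1⟩

/-- The frame `(W₁; W₂)`. -/
def frame12 (B : M24) (W : admissible B) : M24 := ⟨rows W.1 (B.1 0), W.2.2⟩

/-- Smooth functions of `W₁` with compact support in the admissible set. -/
structure IsTest (B : M24) (φ : Twistor → ℝ) : Prop where
  smooth : ContDiff ℝ ∞ φ
  compact : HasCompactSupport φ
  supported : tsupport φ ⊆ admissible B

/-- The pairing of `φ` with `δ⁴(W₁ - s W₂ - t W₃)` as a generalized function of `W₁`. -/
def deltaFour (B : M24) (s t : ℝ) (φ : Twistor → ℝ) : ℝ :=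
  ∫ W, φ W ∂(Measure.dirac (s • B.1 0 + t • B.1 1))

/-- The integrand in `(s, t)` of the delta function with the sign factors. -/
def signedIntegrand (B : M24) (φ : Twistor → ℝ) (p : ℝ × ℝ) : ℝ :=
  1 / p.1 * (1 / p.2) * (Real.sign p.1 * Real.sign p.2) * deltaFour B p.1 p.2 φ

/-- The integrand in `(s, t)` of the delta function without the sign factors. -/
def unsignedIntegrand (B : M24) (φ : Twistor → ℝ) (p : ℝ × ℝ) : ℝ :=
  1 / p.1 * (1 / p.2) * deltaFour B p.1 p.2 φ

/-- `δ(W₁,W₂,W₃) = ∫ ds/s dt/t sgn(s) sgn(t) δ⁴(W₁ - s W₂ - t W₃)`, paired with `φ(W₁)`. -/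
def delta (B : M24) (φ : Twistor → ℝ) : ℝ := ∫ p : ℝ × ℝ, signedIntegrand B φ p

/-- `δ~(W₁,W₂,W₃) = ∫ ds/s dt/t δ⁴(W₁ - s W₂ - t W₃)`, paired with `φ(W₁)`. -/
def deltaTilde (B : M24) (φ : Twistor → ℝ) : ℝ := ∫ p : ℝ × ℝ, unsignedIntegrand B φ p

/-- For a frame `A` and `W₁ = x A`, `W₂ = c₂ A`, `W₃ = c₃ A`, with `c₂, c₃` the rows of `c`, the
rational function `[c₂ c₃] / ([c₃ x] [x c₂])` of `x`, where `[u v] = u₀ v₁ - u₁ v₀`. -/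
def rationalKernel (c : Matrix (Fin 2) (Fin 2) ℝ) (x : ℝ × ℝ) : ℝ :=
  (c 0 0 * c 1 1 - c 0 1 * c 1 0) /
    ((c 1 0 * x.2 - c 1 1 * x.1) * (x.1 * c 0 1 - x.2 * c 0 0))

/-- The point `x A` of the plane spanned by `A`. -/
def planePoint (A : M24) (x : ℝ × ℝ) : Twistor := x.1 • A.1 0 + x.2 • A.1 1

end CollinearDelta

end

noncomputable section

namespace CollinearDelta

/-! ### Frames of a plane -/

/-! Integrating out the delta function turns both pairings into integrals over the plane of `W₂,
W₃`, of `φ(s W₂ + t W₃)` against `1/|st|` (signed) or `1/(st)` (unsigned). Everything about them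
then reduces to the sign of `st`. At `W₁ = s W₂ + t W₃` one has `⟨31⟩⟨12⟩ = st ⟨23⟩²`, and the
frames `(W₃; W₁)` and `(W₁; W₂)` have determinants `-s` and `-t` relative to `(W₂; W₃)`, so their
relative orientation is the sign of `st` (`mul_mul_pos_of_orientedPlane_eq`). Under a change of
frame `c` the kernel `1/(st)` becomes `det c` times `rationalKernel c` and the Jacobian is `|det c|`
(`rationalKernel_vecMul`, `integral_comp_vecMul`). Absolute values cancel completely; without them
the sign of `det c` survives. This is why the signed function lives over the Grassmannian and the
unsigned one only over its double cover. For the spaces, two frames span the same plane iff they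
differ by a matrix `c`, and have the same class in the double cover iff moreover `det c > 0`
(`rowPlane_eq_iff`, `orientedPlane_eq_iff`). The homeomorphisms then follow from quotient maps with
known fibres. A minor is multiplied by `det c`, so its sign trivializes the cover where it is
nonzero. -/

theorem rank_eq_two_iff (B : Matrix (Fin 2) (Fin 4) ℝ) :
    B.rank = 2 ↔ LinearIndependent ℝ B.row := by
  rw [linearIndependent_iff_card_eq_finrank_span, Set.finrank, ← Matrix.rank_eq_finrank_span_row,
    Fintype.card_fin, eq_comm]

theorem linearIndependent_row (B : M24) : LinearIndependent ℝ B.1.row :=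
  (rank_eq_two_iff B.1).1 B.2

/-- Independence of the rows makes transition matrices unique, so the sign of their determinant is
an invariant of a pair of frames. -/
theorem mul_frame_injective (A : M24) :
    Function.Injective fun c : Matrix (Fin 2) (Fin 2) ℝ => c * A.1 := by
  intro c d h
  funext i
  apply Matrix.vecMul_injective_iff.2 (linearIndependent_row A)
  have := congrFun h i
  simpa [Matrix.mul_apply_eq_vecMul] using this

theorem det_ne_zero_of_eq_mul {A B : M24} {c : Matrix (Fin 2) (Fin 2) ℝ} (h : B.1 = c * A.1) :
    c.det ≠ 0 := by
  have hu : IsUnit c := by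
    rw [← Matrix.vecMul_injective_iff_isUnit]
    intro u v huv
    apply Matrix.vecMul_injective_iff.2 (linearIndependent_row B)
    simp only [h, ← Matrix.vecMul_vecMul] at huv ⊢
    rw [huv]
  exact ((Matrix.isUnit_iff_isUnit_det _).1 hu).ne_zero

theorem rowPlane_eq_iff {A B : M24} :
    rowPlane A = rowPlane B ↔ ∃ c : Matrix (Fin 2) (Fin 2) ℝ, B.1 = c * A.1 := by
  constructor
  · intro h
    have hmem : ∀ i, ∃ c : Fin 2 → ℝ, ∑ k, c k • A.1.row k = B.1.row i := fun i => by
      rw [← Submodule.mem_span_range_iff_exists_fun ℝ]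
      have h' : Submodule.span ℝ (Set.range A.1.row) = Submodule.span ℝ (Set.range B.1.row) :=
        congrArg Subtype.val h
      rw [h']
      exact Submodule.subset_span ⟨i, rfl⟩
    choose c hc using hmem
    refine ⟨Matrix.of c, ?_⟩
    ext i j
    have := congrFun (hc i) j
    simpa [Matrix.mul_apply] using this.symm
  · rintro ⟨c, h⟩
    apply Subtype.ext
    symm
    apply Submodule.eq_of_le_of_finrank_eq
    · rw [show (rowPlane B).1 = Submodule.span ℝ (Set.range B.1.row) from rfl, Submodule.span_le]
      rintro _ ⟨i, rfl⟩
      refine (Submodule.mem_span_range_iff_exists_fun ℝ).2 ⟨c i, ?_⟩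
      ext j
      simp [h, Matrix.mul_apply]
    · rw [(rowPlane A).2, (rowPlane B).2]

theorem det_signMatrix (ε : ℤˣ) : (signMatrix ε).det = ((ε : ℤ) : ℝ) := by
  simp [signMatrix]

theorem unit_cast_sq (ε : ℤˣ) : ((ε : ℤ) : ℝ) * ((ε : ℤ) : ℝ) = 1 := by
  rcases Int.units_eq_one_or ε with rfl | rfl <;> norm_num

/-- Scaling by `r` multiplies a `2 × 2` determinant by `r²`, so a matrix of positive determinant is
`√det` times an element of `SL(2, ℝ)`. -/
theorem orientedPlane_eq_iff {A B : M24} :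
    orientedPlane A = orientedPlane B ↔
      ∃ c : Matrix (Fin 2) (Fin 2) ℝ, 0 < c.det ∧ B.1 = c * A.1 := by
  refine Quotient.eq.trans ?_
  constructor
  · rintro ⟨r, hr, g, h⟩
    refine ⟨r • (g : Matrix (Fin 2) (Fin 2) ℝ), ?_, by rw [h, Matrix.smul_mul]⟩
    rw [Matrix.det_smul, g.2]
    positivity
  · rintro ⟨c, hc, h⟩
    have hs : 0 < √c.det := Real.sqrt_pos.2 hc
    refine ⟨√c.det, hs, ⟨(√c.det)⁻¹ • c, ?_⟩, ?_⟩
    · rw [Matrix.det_smul, Fintype.card_fin, inv_pow, Real.sq_sqrt hc.le, inv_mul_cancel₀ hc.ne']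
    · rw [Matrix.smul_mul, smul_smul, mul_inv_cancel₀ hs.ne', one_smul, h]

theorem smul_orientedPlane (ε : ℤˣ) (B : M24) :
    ε • orientedPlane B = orientedPlane (frameMul (signMatrix ε) (isUnit_det_signMatrix ε) B) :=
  rfl

/-- The relative orientation of two frames of one plane is the sign of the determinant of the
transition matrix. -/
theorem orientedPlane_eq_smul_iff {A B : M24} {c : Matrix (Fin 2) (Fin 2) ℝ}
    (h : A.1 = c * B.1) (ε : ℤˣ) :
    orientedPlane A = ε • orientedPlane B ↔ 0 < ((ε : ℤ) : ℝ) * c.det := by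
  have hc := det_ne_zero_of_eq_mul h
  rw [smul_orientedPlane, eq_comm, orientedPlane_eq_iff]
  constructor
  · rintro ⟨d, hd, hd'⟩
    have : c = d * signMatrix ε := mul_frame_injective B (by
      simp only [← h, hd', frameMul, Matrix.mul_assoc])
    rw [this, Matrix.det_mul, det_signMatrix, mul_left_comm, unit_cast_sq, mul_one]
    exact hd
  · intro hpos
    -- `signMatrix ε` is its own inverse, so this matrix takes the flipped frame to `A`.
    refine ⟨c * signMatrix ε, ?_, ?_⟩
    · rw [Matrix.det_mul, det_signMatrix, mul_comm]; exact hpos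
    · rw [frameMul, Matrix.mul_assoc, ← Matrix.mul_assoc (signMatrix ε), signMatrix_sq,
        Matrix.one_mul, h]

theorem exists_unit_mul_pos {d : ℝ} (hd : d ≠ 0) : ∃ ε : ℤˣ, 0 < ((ε : ℤ) : ℝ) * d := by
  rcases lt_or_gt_of_ne hd with h | h
  · exact ⟨-1, by simpa using h⟩
  · exact ⟨1, by simpa using h⟩

theorem rowPlane_eq_iff_orientedPlane {A B : M24} :
    rowPlane A = rowPlane B ↔ ∃ ε : ℤˣ, orientedPlane A = ε • orientedPlane B := by
  rw [eq_comm, rowPlane_eq_iff]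
  constructor
  · rintro ⟨c, h⟩
    obtain ⟨ε, hε⟩ := exists_unit_mul_pos (det_ne_zero_of_eq_mul h)
    exact ⟨ε, (orientedPlane_eq_smul_iff h ε).2 hε⟩
  · rintro ⟨ε, h⟩
    rw [smul_orientedPlane, eq_comm, orientedPlane_eq_iff] at h
    obtain ⟨c, -, h⟩ := h
    exact ⟨c * signMatrix ε, by rw [h, frameMul, Matrix.mul_assoc]⟩

theorem rowPlane_frameMul (g : Matrix (Fin 2) (Fin 2) ℝ) (hg : IsUnit g.det) (B : M24) :
    rowPlane (frameMul g hg B) = rowPlane B :=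
  (rowPlane_eq_iff.2 ⟨g, rfl⟩).symm

theorem unit_eq_of_mul_pos {ε η : ℤˣ} {d : ℝ} (h : 0 < ((ε : ℤ) : ℝ) * d)
    (h' : 0 < ((η : ℤ) : ℝ) * d) : ε = η := by
  rcases Int.units_eq_one_or ε with rfl | rfl <;> rcases Int.units_eq_one_or η with rfl | rfl <;>
    simp at h h' ⊢ <;> linarith

theorem smul_orientedGr_eq_self {ε : ℤˣ} {x : OrientedGr24} (h : ε • x = x) : ε = 1 := by
  induction x using Quotient.inductionOn with
  | h B =>
    have := (orientedPlane_eq_smul_iff (A := B) (B := B) (c := 1) (by simp) ε).1 h.symm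
    exact unit_eq_of_mul_pos this (by simp)

/-! ### Topology of the quotients -/

theorem rowPlane_surjective : Function.Surjective rowPlane := by
  rintro ⟨P, hP⟩
  let b := Module.finBasisOfFinrankEq ℝ P hP
  have hspan : Submodule.span ℝ (Set.range fun i => (b i : Twistor)) = P := by
    have := congrArg (Submodule.map P.subtype) b.span_eq
    rw [Submodule.map_span, Submodule.map_top, Submodule.range_subtype, ← Set.range_comp] at this
    exact this
  have hrow : (Matrix.of fun i => (b i : Twistor)).row = fun i => (b i : Twistor) := rfl
  refine ⟨⟨Matrix.of fun i => (b i : Twistor), ?_⟩, Subtype.ext ?_⟩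
  · rw [Matrix.rank_eq_finrank_span_row, hrow, hspan, hP]
  · exact hspan

theorem isQuotientMap_rowPlane : Topology.IsQuotientMap rowPlane :=
  ⟨⟨rfl⟩, rowPlane_surjective⟩

theorem isQuotientMap_orientedPlane : Topology.IsQuotientMap orientedPlane :=
  isQuotientMap_quotient_mk'

theorem continuous_frameMul (g : Matrix (Fin 2) (Fin 2) ℝ) (hg : IsUnit g.det) :
    Continuous (frameMul g hg) :=
  (continuous_const.matrix_mul continuous_subtype_val).subtype_mk _

theorem continuous_smul_orientedGr (ε : ℤˣ) : Continuous fun x : OrientedGr24 => ε • x :=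
  isQuotientMap_orientedPlane.continuous_iff.2
    (isQuotientMap_orientedPlane.continuous.comp (continuous_frameMul _ _))

/-- The plane underlying an oriented plane. -/
def toGr (x : OrientedGr24) : Gr24 :=
  Quotient.lift rowPlane (fun A B h => by
    obtain ⟨c, -, hc⟩ := orientedPlane_eq_iff.1 (Quotient.sound h)
    exact rowPlane_eq_iff.2 ⟨c, hc⟩) x

theorem toGr_orientedPlane (B : M24) : toGr (orientedPlane B) = rowPlane B := rfl

theorem continuous_toGr : Continuous toGr :=
  isQuotientMap_orientedPlane.continuous_iff.2 isQuotientMap_rowPlane.continuous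

theorem toGr_eq_iff {x y : OrientedGr24} : toGr x = toGr y ↔ ∃ ε : ℤˣ, x = ε • y := by
  induction x using Quotient.inductionOn with
  | h A =>
    induction y using Quotient.inductionOn with
    | h B => exact rowPlane_eq_iff_orientedPlane

theorem toGr_smul (ε : ℤˣ) (x : OrientedGr24) : toGr (ε • x) = toGr x :=
  toGr_eq_iff.2 ⟨ε, rfl⟩

/-- The composite `toGr ∘ orientedPlane` is the quotient map `rowPlane`, which forces its last
factor to be one. -/
theorem isQuotientMap_toGr : Topology.IsQuotientMap toGr :=
  Topology.IsQuotientMap.of_comp isQuotientMap_orientedPlane.continuous continuous_toGr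
    isQuotientMap_rowPlane

/-- A quotient map identifies its target with the quotient by any setoid describing its fibres. -/
theorem exists_homeomorph_of_isQuotientMap {X Y : Type*} [TopologicalSpace X] [TopologicalSpace Y]
    {f : X → Y} (hf : Topology.IsQuotientMap f) (s : Setoid X)
    (hs : ∀ a b, s.r a b ↔ f a = f b) :
    ∃ e : Quotient s ≃ₜ Y, ∀ x, e (Quotient.mk s x) = f x := by
  let g : Quotient s → Y := Quotient.lift f fun a b h => (hs a b).1 h
  have hg : Function.Bijective g := by
    constructor
    · intro a b
      induction a using Quotient.inductionOn
      induction b using Quotient.inductionOn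
      exact fun h => Quotient.sound ((hs _ _).2 h)
    · intro y
      obtain ⟨x, rfl⟩ := hf.surjective y
      exact ⟨Quotient.mk s x, rfl⟩
  have hc : Continuous g := hf.continuous.quotient_lift _
  refine ⟨⟨Equiv.ofBijective g hg, hc, ?_⟩, fun x => rfl⟩
  -- Continuity of the inverse is tested after composing with `f`, where it becomes the quotient
  -- projection.
  rw [hf.continuous_iff]
  have : (Equiv.ofBijective g hg).invFun ∘ f = Quotient.mk s := by
    funext x
    exact (Equiv.ofBijective g hg).symm_apply_apply (Quotient.mk s x)
  rw [this]
  exact continuous_quotient_mk'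

theorem exists_homeomorph_frameModGL :
    ∃ e : FrameModGL ≃ₜ Gr24, ∀ B : M24, e (Quotient.mk glSetoid B) = rowPlane B := by
  refine exists_homeomorph_of_isQuotientMap isQuotientMap_rowPlane glSetoid fun A B => ?_
  rw [rowPlane_eq_iff]
  constructor
  · rintro ⟨g, h⟩
    exact ⟨g, h⟩
  · rintro ⟨c, h⟩
    exact ⟨Matrix.GeneralLinearGroup.mkOfDetNeZero c (det_ne_zero_of_eq_mul h), h⟩

theorem exists_homeomorph_orbitQuotient :
    ∃ e : MulAction.orbitRel.Quotient ℤˣ OrientedGr24 ≃ₜ Gr24,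
      ∀ B : M24, e (Quotient.mk _ (orientedPlane B)) = rowPlane B := by
  obtain ⟨e, he⟩ := exists_homeomorph_of_isQuotientMap isQuotientMap_toGr
    (MulAction.orbitRel ℤˣ OrientedGr24) fun x y => by
      rw [toGr_eq_iff]
      exact ⟨fun ⟨ε, h⟩ => ⟨ε, h.symm⟩, fun ⟨ε, h⟩ => ⟨ε, h.symm⟩⟩
  exact ⟨e, fun B => he _⟩

/-! ### Minors and the trivialization -/

/-- Multiplicativity of determinants on two columns: vanishing of a minor depends only on the plane,
its sign only on the oriented plane. -/
theorem minor_of_eq_mul {A B : M24} {c : Matrix (Fin 2) (Fin 2) ℝ} (h : B.1 = c * A.1)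
    (i j : Fin 4) : minor B i j = c.det * minor A i j := by
  simp only [minor, h, Matrix.mul_apply, Fin.sum_univ_two, Matrix.det_fin_two]
  ring

theorem minor_frameMul_signMatrix (ε : ℤˣ) (B : M24) (i j : Fin 4) :
    minor (frameMul (signMatrix ε) (isUnit_det_signMatrix ε) B) i j =
      ((ε : ℤ) : ℝ) * minor B i j := by
  rw [minor_of_eq_mul (A := B) rfl, det_signMatrix]

theorem continuous_minor (i j : Fin 4) : Continuous fun B : M24 => minor B i j := by
  have h : ∀ a b, Continuous fun B : M24 => B.1 a b := fun a b =>
    continuous_subtype_val.matrix_elem a b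
  exact ((h _ _).mul (h _ _)).sub ((h _ _).mul (h _ _))

theorem minor_ne_zero_iff {A B : M24} (h : rowPlane A = rowPlane B) (i j : Fin 4) :
    minor A i j ≠ 0 ↔ minor B i j ≠ 0 := by
  obtain ⟨c, hc⟩ := rowPlane_eq_iff.1 h
  rw [minor_of_eq_mul hc]
  simp [det_ne_zero_of_eq_mul hc]

/-- The set is saturated, so openness upstairs passes to its image in the quotient. -/
theorem preimage_image_rowPlane (i j : Fin 4) :
    rowPlane ⁻¹' (rowPlane '' {B | minor B i j ≠ 0}) = {B | minor B i j ≠ 0} := by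
  ext B
  constructor
  · rintro ⟨A, hA, h⟩
    exact (minor_ne_zero_iff h i j).1 hA
  · exact fun h => ⟨B, h, rfl⟩

theorem preimage_image_orientedPlane (i j : Fin 4) :
    orientedPlane ⁻¹' (orientedPlane '' {B | minor B i j ≠ 0}) = {B | minor B i j ≠ 0} := by
  ext B
  constructor
  · rintro ⟨A, hA, h⟩
    exact (minor_ne_zero_iff (congrArg toGr h) i j).1 hA
  · exact fun h => ⟨B, h, rfl⟩

theorem isOpen_minor_ne_zero (i j : Fin 4) : IsOpen {B : M24 | minor B i j ≠ 0} :=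
  isOpen_ne_fun (continuous_minor i j) continuous_const

theorem isOpen_image_rowPlane (i j : Fin 4) : IsOpen (rowPlane '' {B | minor B i j ≠ 0}) := by
  rw [← isQuotientMap_rowPlane.isOpen_preimage, preimage_image_rowPlane]
  exact isOpen_minor_ne_zero i j

theorem isOpen_image_orientedPlane (i j : Fin 4) :
    IsOpen (orientedPlane '' {B | minor B i j ≠ 0}) := by
  rw [← isQuotientMap_orientedPlane.isOpen_preimage, preimage_image_orientedPlane]
  exact isOpen_minor_ne_zero i j

/-- The weak inequality allows a choice for every plane, including those where the minor vanishes;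
there the orientation is arbitrary, hence continuity is claimed only elsewhere. -/
theorem exists_frame_minor_nonneg (i j : Fin 4) (P : Gr24) :
    ∃ B : M24, rowPlane B = P ∧ 0 ≤ minor B i j := by
  obtain ⟨B, rfl⟩ := rowPlane_surjective P
  rcases le_total 0 (minor B i j) with h | h
  · exact ⟨B, rfl, h⟩
  · refine ⟨frameMul (signMatrix (-1)) (isUnit_det_signMatrix (-1)) B, rowPlane_frameMul _ _ _, ?_⟩
    rw [minor_frameMul_signMatrix]
    simpa using h

/-- A frame of a plane whose minor on the columns `i, j` is not negative. -/
def baseFrame (i j : Fin 4) (P : Gr24) : M24 := (exists_frame_minor_nonneg i j P).choose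

theorem rowPlane_baseFrame (i j : Fin 4) (P : Gr24) : rowPlane (baseFrame i j P) = P :=
  (exists_frame_minor_nonneg i j P).choose_spec.1

theorem minor_baseFrame_nonneg (i j : Fin 4) (P : Gr24) : 0 ≤ minor (baseFrame i j P) i j :=
  (exists_frame_minor_nonneg i j P).choose_spec.2

/-- The bijection of `Gr × O(1)` with the oriented Grassmannian sending `(P, ε)` to `ε` times the
orientation of the chosen frame of `P`. -/
def trivialization (i j : Fin 4) : Gr24 × ℤˣ ≃ OrientedGr24 :=
  Equiv.ofBijective (fun p => p.2 • orientedPlane (baseFrame i j p.1)) (by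
    have key : ∀ p : Gr24 × ℤˣ, toGr (p.2 • orientedPlane (baseFrame i j p.1)) = p.1 := fun p => by
      rw [toGr_smul, toGr_orientedPlane, rowPlane_baseFrame]
    constructor
    · rintro ⟨P, ε⟩ ⟨Q, η⟩ h
      have hPQ : P = Q := (key (P, ε)).symm.trans ((congrArg toGr h).trans (key (Q, η)))
      subst hPQ
      have h' : (η⁻¹ * ε) • orientedPlane (baseFrame i j P) = orientedPlane (baseFrame i j P) := by
        rw [mul_smul, inv_smul_eq_iff]; exact h
      rw [inv_mul_eq_one.1 (smul_orientedGr_eq_self h')]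
    · intro x
      obtain ⟨ε, h⟩ := toGr_eq_iff.1
        (show toGr x = toGr (orientedPlane (baseFrame i j (toGr x))) from
          (rowPlane_baseFrame i j (toGr x)).symm)
      exact ⟨(toGr x, ε), h.symm⟩)

theorem trivialization_apply (i j : Fin 4) (p : Gr24 × ℤˣ) :
    trivialization i j p = p.2 • orientedPlane (baseFrame i j p.1) := rfl

theorem trivialization_symm_fst (i j : Fin 4) (x : OrientedGr24) :
    ((trivialization i j).symm x).1 = toGr x := by
  obtain ⟨p, rfl⟩ := (trivialization i j).surjective x
  rw [Equiv.symm_apply_apply, trivialization_apply, toGr_smul, toGr_orientedPlane,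
    rowPlane_baseFrame]

theorem trivialization_symm_smul (i j : Fin 4) (ε : ℤˣ) (x : OrientedGr24) :
    (trivialization i j).symm (ε • x) =
      (((trivialization i j).symm x).1, ε * ((trivialization i j).symm x).2) := by
  obtain ⟨p, rfl⟩ := (trivialization i j).surjective x
  rw [Equiv.symm_apply_apply, Equiv.symm_apply_eq, trivialization_apply, trivialization_apply,
    mul_smul]

/-- The sign of a minor orients its plane compatibly with `trivialization`. -/
theorem orientedPlane_baseFrame {i j : Fin 4} {B : M24} {ε : ℤˣ}
    (h : 0 < ((ε : ℤ) : ℝ) * minor B i j) :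
    orientedPlane B = ε • orientedPlane (baseFrame i j (rowPlane B)) := by
  have hB : minor B i j ≠ 0 := fun h0 => by simp [h0] at h
  obtain ⟨c, hc⟩ := rowPlane_eq_iff.1 (rowPlane_baseFrame i j (rowPlane B))
  have hm := minor_of_eq_mul hc i j
  -- The two minors are proportional and that of `B` is nonzero, so the weak inequality becomes
  -- strict.
  have hpos : 0 < minor (baseFrame i j (rowPlane B)) i j :=
    lt_of_le_of_ne (minor_baseFrame_nonneg _ _ _) fun h0 => hB (by rw [hm, ← h0, mul_zero])
  rw [orientedPlane_eq_smul_iff hc]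
  rw [hm, ← mul_assoc] at h
  exact pos_of_mul_pos_left h hpos.le

theorem trivialization_symm_orientedPlane {i j : Fin 4} {B : M24} {ε : ℤˣ}
    (h : 0 < ((ε : ℤ) : ℝ) * minor B i j) :
    (trivialization i j).symm (orientedPlane B) = (rowPlane B, ε) := by
  rw [Equiv.symm_apply_eq, trivialization_apply]
  exact orientedPlane_baseFrame h

theorem eventually_mul_minor_pos {i j : Fin 4} {B : M24} {ε : ℤˣ}
    (h : 0 < ((ε : ℤ) : ℝ) * minor B i j) :
    ∀ᶠ A in nhds B, 0 < ((ε : ℤ) : ℝ) * minor A i j :=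
  (continuous_const.mul (continuous_minor i j)).continuousAt.eventually (lt_mem_nhds h)

/-- Continuity can be checked on frames; near a given frame the minor keeps its sign, so the second
component is locally constant. -/
theorem continuousOn_trivialization_symm (i j : Fin 4) :
    ContinuousOn (trivialization i j).symm (orientedPlane '' {B | minor B i j ≠ 0}) := by
  rw [isQuotientMap_orientedPlane.continuousOn_isOpen_iff (isOpen_image_orientedPlane i j),
    preimage_image_orientedPlane]
  intro B hB
  obtain ⟨ε, hε⟩ := exists_unit_mul_pos hB
  apply ContinuousAt.continuousWithinAt
  have hc : ContinuousAt (fun A => (rowPlane A, ε)) B :=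
    (isQuotientMap_rowPlane.continuous.prodMk continuous_const).continuousAt
  refine hc.congr ?_
  filter_upwards [eventually_mul_minor_pos hε] with A hA
  exact (trivialization_symm_orientedPlane hA).symm

/-- The chosen frame need not vary continuously, but its orientation is fixed by the sign of the
minor and so agrees locally with `ε⁻¹ • orientedPlane A`. -/
theorem continuousOn_baseFrame (i j : Fin 4) :
    ContinuousOn (fun P => orientedPlane (baseFrame i j P))
      (rowPlane '' {B | minor B i j ≠ 0}) := by
  rw [isQuotientMap_rowPlane.continuousOn_isOpen_iff (isOpen_image_rowPlane i j),
    preimage_image_rowPlane]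
  intro B hB
  obtain ⟨ε, hε⟩ := exists_unit_mul_pos hB
  apply ContinuousAt.continuousWithinAt
  have hc : ContinuousAt (fun A => ε⁻¹ • orientedPlane A) B :=
    ((continuous_smul_orientedGr ε⁻¹).comp isQuotientMap_orientedPlane.continuous).continuousAt
  refine hc.congr ?_
  filter_upwards [eventually_mul_minor_pos hε] with A hA
  rw [inv_smul_eq_iff]
  exact orientedPlane_baseFrame hA

theorem continuousOn_trivialization (i j : Fin 4) :
    ContinuousOn (trivialization i j) ((rowPlane '' {B | minor B i j ≠ 0}) ×ˢ Set.univ) := by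
  rintro ⟨P, ε⟩ ⟨hP, -⟩
  apply ContinuousAt.continuousWithinAt
  have hb := (continuousOn_baseFrame i j).continuousAt ((isOpen_image_rowPlane i j).mem_nhds hP)
  have hc : ContinuousAt (fun p : Gr24 × ℤˣ => ε • orientedPlane (baseFrame i j p.1)) (P, ε) :=
    (continuous_smul_orientedGr ε).continuousAt.comp
      (ContinuousAt.comp (f := Prod.fst) (g := fun P => orientedPlane (baseFrame i j P))
        (x := (P, ε)) hb continuousAt_fst)
  refine hc.congr ?_
  -- `ℤˣ` is discrete, so the sign may be frozen near the point.
  have : ∀ᶠ p : Gr24 × ℤˣ in nhds (P, ε), p.2 = ε :=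
    (continuous_snd.tendsto (P, ε)).eventually
      (show ∀ᶠ η in nhds ε, η = ε by simp [nhds_discrete])
  filter_upwards [this] with p hp
  rw [trivialization_apply, hp]

theorem exists_trivialization (i j : Fin 4) :
    ∃ e : OrientedGr24 ≃ Gr24 × ℤˣ,
      (∀ B : M24, (e (orientedPlane B)).1 = rowPlane B) ∧
      (∀ (ε : ℤˣ) (x : OrientedGr24), e (ε • x) = ((e x).1, ε * (e x).2)) ∧
      (∀ B : M24, minor B i j ≠ 0 →
        (((e (orientedPlane B)).2 : ℤ) : ℝ) = Real.sign (minor B i j)) ∧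
      IsOpen (orientedPlane '' {B | minor B i j ≠ 0}) ∧
      IsOpen (rowPlane '' {B | minor B i j ≠ 0}) ∧
      ContinuousOn e (orientedPlane '' {B | minor B i j ≠ 0}) ∧
      ContinuousOn e.symm ((rowPlane '' {B | minor B i j ≠ 0}) ×ˢ Set.univ) := by
  refine ⟨(trivialization i j).symm, fun B => trivialization_symm_fst i j _,
    trivialization_symm_smul i j, fun B hB => ?_, isOpen_image_orientedPlane i j,
    isOpen_image_rowPlane i j, continuousOn_trivialization_symm i j,
    continuousOn_trivialization i j⟩
  rcases lt_or_gt_of_ne hB with h | h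
  · rw [trivialization_symm_orientedPlane (ε := -1) (by simpa using h), Real.sign_of_neg h]
    simp
  · rw [trivialization_symm_orientedPlane (ε := 1) (by simpa using h), Real.sign_of_pos h]
    simp

/-! ### The integrands -/

theorem deltaFour_eq (B : M24) (s t : ℝ) (φ : Twistor → ℝ) :
    deltaFour B s t φ = φ (planePoint B (s, t)) :=
  integral_dirac _ _

theorem unsignedIntegrand_eq (B : M24) (φ : Twistor → ℝ) (p : ℝ × ℝ) :
    unsignedIntegrand B φ p = 1 / (p.1 * p.2) * φ (planePoint B p) := by
  rw [unsignedIntegrand, deltaFour_eq, one_div_mul_one_div]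

theorem real_sign_mul (x y : ℝ) : Real.sign (x * y) = Real.sign x * Real.sign y := by
  rcases lt_trichotomy x 0 with hx | rfl | hx <;> rcases lt_trichotomy y 0 with hy | rfl | hy <;>
    simp [Real.sign_of_neg, Real.sign_of_pos, mul_pos_of_neg_of_neg, mul_neg_of_neg_of_pos,
      mul_neg_of_pos_of_neg, *]

theorem signedIntegrand_eq_sign_mul (B : M24) (φ : Twistor → ℝ) (p : ℝ × ℝ) :
    signedIntegrand B φ p = Real.sign (p.1 * p.2) * unsignedIntegrand B φ p := by
  rw [signedIntegrand, unsignedIntegrand, real_sign_mul]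
  ring

theorem sign_mul_one_div (x : ℝ) : Real.sign x * (1 / x) = |1 / x| := by
  rcases lt_trichotomy x 0 with h | rfl | h
  · rw [Real.sign_of_neg h, abs_of_neg (one_div_neg.2 h)]; ring
  -- At zero both sides vanish by the conventions `sign 0 = 0` and `1 / 0 = 0`, so the kernel
  -- identities hold pointwise, also on the axes.
  · simp
  · rw [Real.sign_of_pos h, abs_of_pos (one_div_pos.2 h)]; ring

theorem signedIntegrand_eq (B : M24) (φ : Twistor → ℝ) (p : ℝ × ℝ) :
    signedIntegrand B φ p = |1 / (p.1 * p.2)| * φ (planePoint B p) := by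
  rw [signedIntegrand_eq_sign_mul, unsignedIntegrand_eq, ← mul_assoc, sign_mul_one_div]

/-! ### Points of the plane -/

theorem linearIndependent_rows_iff (X Y : Twistor) :
    (rows X Y).rank = 2 ↔ ∀ s t : ℝ, s • X + t • Y = 0 → s = 0 ∧ t = 0 := by
  rw [rank_eq_two_iff, ← LinearIndependent.pair_iff]
  rfl

/-- On the axes `W₁` is a multiple of `W₂` or of `W₃`; admissibility thus removes exactly the poles
of the kernel from the support. -/
theorem mul_ne_zero_of_admissible {B : M24} {p : ℝ × ℝ} (h : planePoint B p ∈ admissible B) :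
    p.1 * p.2 ≠ 0 := by
  obtain ⟨h1, h2⟩ := h
  rw [linearIndependent_rows_iff] at h1 h2
  refine mul_ne_zero (fun h0 => ?_) (fun h0 => ?_)
  · have := (h1 (-p.2) 1 (by simp [planePoint, h0])).2
    exact one_ne_zero this
  · have := (h2 1 (-p.1) (by simp [planePoint, h0])).1
    exact one_ne_zero this

theorem IsTest.mem_admissible {B : M24} {φ : Twistor → ℝ} (h : IsTest B φ) {W : Twistor}
    (hW : φ W ≠ 0) : W ∈ admissible B :=
  h.supported (subset_tsupport _ hW)

theorem frame31_eq_mul {B : M24} {p : ℝ × ℝ} (h : planePoint B p ∈ admissible B) :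
    (frame31 B ⟨_, h⟩).1 = !![0, 1; p.1, p.2] * B.1 := by
  ext i j
  fin_cases i <;> simp [frame31, rows, planePoint, Matrix.mul_apply]

theorem frame12_eq_mul {B : M24} {p : ℝ × ℝ} (h : planePoint B p ∈ admissible B) :
    (frame12 B ⟨_, h⟩).1 = !![p.1, p.2; 1, 0] * B.1 := by
  ext i j
  fin_cases i <;> simp [frame12, rows, planePoint, Matrix.mul_apply]

/-- The transition matrices from `B` have determinants `-s` and `-t`; their product `st` carries the
relative orientation. -/
theorem mul_mul_pos_of_orientedPlane_eq {B : M24} {p : ℝ × ℝ} {ε : ℤˣ}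
    (h : planePoint B p ∈ admissible B)
    (hε : orientedPlane (frame31 B ⟨_, h⟩) = ε • orientedPlane (frame12 B ⟨_, h⟩)) :
    0 < ((ε : ℤ) : ℝ) * (p.1 * p.2) := by
  have h2 := frame12_eq_mul h
  -- Both frames are compared with `B`; the auxiliary sign `η` of `-t` enters twice and cancels.
  obtain ⟨η, hη⟩ := exists_unit_mul_pos (det_ne_zero_of_eq_mul h2)
  rw [(orientedPlane_eq_smul_iff h2 η).2 hη, ← mul_smul,
    orientedPlane_eq_smul_iff (frame31_eq_mul h)] at hε
  rw [Matrix.det_fin_two] at hη hε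
  simp only [Matrix.of_apply, Matrix.cons_val', Matrix.cons_val_zero, Matrix.cons_val_one,
    Matrix.cons_val_fin_one] at hη hε
  have := mul_pos hη hε
  push_cast at this
  have hs := unit_cast_sq η
  calc (0 : ℝ) < _ := this
    _ = (((η : ℤ) : ℝ) * ((η : ℤ) : ℝ)) * (((ε : ℤ) : ℝ) * (p.1 * p.2)) := by ring
    _ = _ := by rw [hs, one_mul]

theorem sign_eq_unit {ε : ℤˣ} {x : ℝ} (h : 0 < ((ε : ℤ) : ℝ) * x) :
    Real.sign x = ((ε : ℤ) : ℝ) := by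
  rcases Int.units_eq_one_or ε with rfl | rfl
  · rw [Real.sign_of_pos (by simpa using h)]; simp
  · rw [Real.sign_of_neg (by simpa using h)]; simp

/-- Antisymmetry gives `⟨31⟩ = s ⟨32⟩` and `⟨12⟩ = t ⟨32⟩`. -/
theorem bracket_mul_bracket_planePoint (B : M24) (p : ℝ × ℝ) :
    bracket (B.1 1) (planePoint B p) * bracket (planePoint B p) (B.1 0) =
      (p.1 * p.2) * bracket (B.1 0) (B.1 1) ^ 2 := by
  simp only [bracket, planePoint, Pi.add_apply, Pi.smul_apply, smul_eq_mul]
  ring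

theorem delta_eq_deltaTilde_sign (B : M24) (φ : Twistor → ℝ)
    (h : bracket (B.1 0) (B.1 1) ≠ 0) :
    delta B φ = deltaTilde B fun W =>
      Real.sign (bracket (B.1 1) W * bracket W (B.1 0)) * φ W := by
  refine integral_congr_ae (.of_forall fun p => ?_)
  rw [signedIntegrand_eq_sign_mul, unsignedIntegrand_eq, unsignedIntegrand_eq,
    bracket_mul_bracket_planePoint, real_sign_mul (p.1 * p.2),
    Real.sign_of_pos (sq_pos_of_ne_zero h)]
  ring

theorem delta_eq_zero_of_vanish {B : M24} {φ : Twistor → ℝ} (hφ : IsTest B φ)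
    (h : ∀ W : admissible B, rowPlane (frame31 B W) = rowPlane B →
      rowPlane (frame12 B W) = rowPlane B → φ W = 0) :
    delta B φ = 0 ∧ deltaTilde B φ = 0 := by
  have hz : ∀ p, φ (planePoint B p) = 0 := fun p => by
    by_contra hp
    have ha := hφ.mem_admissible hp
    exact hp (h ⟨_, ha⟩ (rowPlane_eq_iff.2 ⟨_, frame31_eq_mul ha⟩).symm
      (rowPlane_eq_iff.2 ⟨_, frame12_eq_mul ha⟩).symm)
  simp [delta, deltaTilde, signedIntegrand_eq, unsignedIntegrand_eq, hz]

theorem deltaTilde_eq_mul_delta {B : M24} {φ : Twistor → ℝ} {ε : ℤˣ} (hφ : IsTest B φ)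
    (h : ∀ W : admissible B, rowPlane (frame31 B W) = rowPlane (frame12 B W) →
      orientedPlane (frame31 B W) ≠ ε • orientedPlane (frame12 B W) → φ W = 0) :
    deltaTilde B φ = ((ε : ℤ) : ℝ) * delta B φ := by
  rw [deltaTilde, delta, ← integral_const_mul]
  refine integral_congr_ae (.of_forall fun p => ?_)
  simp only
  by_cases hp : φ (planePoint B p) = 0
  · simp [signedIntegrand_eq, unsignedIntegrand_eq, hp]
  · have ha := hφ.mem_admissible hp
    -- Where `φ` is nonzero the two frames are related by exactly `ε`, so the sign of `st` is `ε`
    -- there.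
    have hε : orientedPlane (frame31 B ⟨_, ha⟩) = ε • orientedPlane (frame12 B ⟨_, ha⟩) := by
      by_contra hne
      exact hp (h ⟨_, ha⟩ ((rowPlane_eq_iff.2 ⟨_, frame31_eq_mul ha⟩).symm.trans
        (rowPlane_eq_iff.2 ⟨_, frame12_eq_mul ha⟩)) hne)
    rw [signedIntegrand_eq_sign_mul, sign_eq_unit (mul_mul_pos_of_orientedPlane_eq ha hε),
      ← mul_assoc, unit_cast_sq, one_mul]

/-! ### Convergence -/

/-- Closedness is what makes the compact support of `φ` compact in `(s, t)`. -/
theorem isClosedEmbedding_planePoint (B : M24) : Topology.IsClosedEmbedding (planePoint B) := by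
  let f : ℝ × ℝ →ₗ[ℝ] Twistor :=
    (LinearMap.toSpanSingleton ℝ Twistor (B.1 0)).coprod
      (LinearMap.toSpanSingleton ℝ Twistor (B.1 1))
  have hf : ⇑f = planePoint B := by
    funext p
    simp [f, planePoint]
  rw [← hf]
  apply LinearMap.isClosedEmbedding_of_injective
  rw [LinearMap.ker_eq_bot']
  intro p hp
  rw [hf] at hp
  have hB : (rows (B.1 0) (B.1 1)).rank = 2 := by
    have : rows (B.1 0) (B.1 1) = B.1 := by ext i j; fin_cases i <;> rfl
    rw [this, B.2]
  have := (linearIndependent_rows_iff _ _).1 hB p.1 p.2 hp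
  exact Prod.ext this.1 this.2

theorem IsTest.hasCompactSupport_comp {B : M24} {φ : Twistor → ℝ} (h : IsTest B φ) :
    HasCompactSupport (φ ∘ planePoint B) :=
  h.compact.comp_isClosedEmbedding (isClosedEmbedding_planePoint B)

theorem isOpen_mul_ne_zero : IsOpen {p : ℝ × ℝ | p.1 * p.2 ≠ 0} :=
  isOpen_ne_fun (continuous_fst.mul continuous_snd) continuous_const

theorem IsTest.tsupport_comp_subset {B : M24} {φ : Twistor → ℝ} (h : IsTest B φ) :
    tsupport (φ ∘ planePoint B) ⊆ {p : ℝ × ℝ | p.1 * p.2 ≠ 0} := fun _ hp =>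
  mul_ne_zero_of_admissible (h.supported
    (tsupport_comp_subset_preimage φ (isClosedEmbedding_planePoint B).continuous hp))

/-- The kernel may be singular on the axes, but the closed support of the pulled-back `φ` avoids
them. -/
theorem IsTest.continuous_mul {B : M24} {φ : Twistor → ℝ} (h : IsTest B φ) {k : ℝ × ℝ → ℝ}
    (hk : ContinuousOn k {p : ℝ × ℝ | p.1 * p.2 ≠ 0}) :
    Continuous fun p => k p * φ (planePoint B p) :=
  (hk.mul (h.smooth.continuous.comp
    (isClosedEmbedding_planePoint B).continuous).continuousOn).continuous_of_tsupport_subset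
    isOpen_mul_ne_zero ((tsupport_mul_subset_right (f := k)).trans h.tsupport_comp_subset)

theorem continuousOn_one_div_mul :
    ContinuousOn (fun p : ℝ × ℝ => 1 / (p.1 * p.2)) {p : ℝ × ℝ | p.1 * p.2 ≠ 0} :=
  continuousOn_const.div (continuous_fst.mul continuous_snd).continuousOn fun _ hp => hp

theorem IsTest.continuous_unsignedIntegrand {B : M24} {φ : Twistor → ℝ} (h : IsTest B φ) :
    Continuous (unsignedIntegrand B φ) := by
  rw [funext (unsignedIntegrand_eq B φ)]
  exact h.continuous_mul continuousOn_one_div_mul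

theorem IsTest.hasCompactSupport_unsignedIntegrand {B : M24} {φ : Twistor → ℝ}
    (h : IsTest B φ) : HasCompactSupport (unsignedIntegrand B φ) := by
  rw [funext (unsignedIntegrand_eq B φ)]
  exact h.hasCompactSupport_comp.mul_left

theorem IsTest.integrable {B : M24} {φ : Twistor → ℝ} (h : IsTest B φ) :
    Integrable (signedIntegrand B φ) ∧ Integrable (unsignedIntegrand B φ) := by
  refine ⟨?_, h.continuous_unsignedIntegrand.integrable_of_hasCompactSupport
    h.hasCompactSupport_unsignedIntegrand⟩
  rw [funext (signedIntegrand_eq B φ)]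
  exact (h.continuous_mul continuousOn_one_div_mul.abs).integrable_of_hasCompactSupport
    h.hasCompactSupport_comp.mul_left

/-! ### Change of frame -/

theorem integral_comp_vecMul {c : Matrix (Fin 2) (Fin 2) ℝ} (hc : c.det ≠ 0)
    (F : ℝ × ℝ → ℝ) :
    ∫ x, F x = |c.det| *
      ∫ p : ℝ × ℝ, F (c 0 0 * p.1 + c 1 0 * p.2, c 0 1 * p.1 + c 1 1 * p.2) := by
  -- The transpose of `c` appears because points are row vectors multiplied by `c` on the right,
  -- while `Matrix.toLin` acts on columns.
  let f : ℝ × ℝ →ₗ[ℝ] ℝ × ℝ := Matrix.toLin (Module.Basis.finTwoProd ℝ)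
    (Module.Basis.finTwoProd ℝ) !![c 0 0, c 1 0; c 0 1, c 1 1]
  have hf : ∀ p, f p = (c 0 0 * p.1 + c 1 0 * p.2, c 0 1 * p.1 + c 1 1 * p.2) :=
    Matrix.toLin_finTwoProd_apply _ _ _ _
  have hdet : LinearMap.det f = c.det := by
    rw [LinearMap.det_toLin, Matrix.det_fin_two_of, Matrix.det_fin_two]
    ring
  have hbij : Function.Bijective f :=
    (LinearMap.equivOfDetNeZero f (by rwa [hdet])).bijective
  have key := integral_image_eq_integral_abs_det_fderiv_smul volume MeasurableSet.univ
    (fun x _ => (LinearMap.toContinuousLinearMap f).hasFDerivAt.hasFDerivWithinAt)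
    hbij.injective.injOn F
  rw [LinearMap.coe_toContinuousLinearMap', Set.image_univ, hbij.surjective.range_eq,
    setIntegral_univ, setIntegral_univ] at key
  rw [key, ← integral_const_mul]
  simp only [LinearMap.det_toContinuousLinearMap, hdet, smul_eq_mul, hf]

theorem planePoint_vecMul {A B : M24} {c : Matrix (Fin 2) (Fin 2) ℝ} (h : B.1 = c * A.1)
    (p : ℝ × ℝ) :
    planePoint A (c 0 0 * p.1 + c 1 0 * p.2, c 0 1 * p.1 + c 1 1 * p.2) = planePoint B p := by
  ext j
  simp only [planePoint, h, Matrix.mul_apply, Fin.sum_univ_two, Pi.add_apply, Pi.smul_apply,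
    smul_eq_mul]
  ring

/-- For `x = s c₂ + t c₃` the brackets `[c₃ x]` and `[x c₂]` equal `-s det c` and `-t det c`,
against one `det c` in the numerator. -/
theorem rationalKernel_vecMul {c : Matrix (Fin 2) (Fin 2) ℝ} (hc : c.det ≠ 0) (p : ℝ × ℝ) :
    rationalKernel c (c 0 0 * p.1 + c 1 0 * p.2, c 0 1 * p.1 + c 1 1 * p.2) =
      c.det⁻¹ * (1 / (p.1 * p.2)) := by
  have h : rationalKernel c (c 0 0 * p.1 + c 1 0 * p.2, c 0 1 * p.1 + c 1 1 * p.2) =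
      c.det / ((c.det * c.det) * (p.1 * p.2)) := by
    simp only [rationalKernel, Matrix.det_fin_two]
    congr 1
    ring
  rw [h, ← div_div, div_mul_cancel_left₀ hc, div_eq_mul_one_div]

theorem delta_eq_integral_kernel {A B : M24} {c : Matrix (Fin 2) (Fin 2) ℝ}
    (h : B.1 = c * A.1) (φ : Twistor → ℝ) :
    delta B φ = ∫ x : ℝ × ℝ, |rationalKernel c x| * φ (planePoint A x) := by
  have hc := det_ne_zero_of_eq_mul h
  rw [integral_comp_vecMul hc, ← integral_const_mul]
  refine integral_congr_ae (.of_forall fun p => ?_)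
  simp only
  rw [rationalKernel_vecMul hc, planePoint_vecMul h, signedIntegrand_eq, abs_mul, abs_inv,
    mul_assoc, mul_inv_cancel_left₀ (abs_ne_zero.2 hc)]

theorem abs_eq_unit_mul {ε : ℤˣ} {x : ℝ} (h : 0 < ((ε : ℤ) : ℝ) * x) :
    |x| = ((ε : ℤ) : ℝ) * x := by
  rcases Int.units_eq_one_or ε with rfl | rfl
  · rw [abs_of_pos (by simpa using h)]; simp
  · rw [abs_of_neg (by simpa using h)]; simp

/-- The Jacobian `|det c|` meets the factor `(det c)⁻¹` of the kernel and leaves the sign of `det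
c`, which is `ε`. -/
theorem deltaTilde_eq_integral_kernel {A B : M24} {c : Matrix (Fin 2) (Fin 2) ℝ}
    (h : B.1 = c * A.1) {ε : ℤˣ} (hε : 0 < ((ε : ℤ) : ℝ) * c.det) (φ : Twistor → ℝ) :
    deltaTilde B φ =
      ((ε : ℤ) : ℝ) * ∫ x : ℝ × ℝ, rationalKernel c x * φ (planePoint A x) := by
  have hc := det_ne_zero_of_eq_mul h
  rw [integral_comp_vecMul hc, abs_eq_unit_mul hε, ← mul_assoc, ← mul_assoc, unit_cast_sq,
    one_mul, ← integral_const_mul]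
  refine integral_congr_ae (.of_forall fun p => ?_)
  simp only
  rw [rationalKernel_vecMul hc, planePoint_vecMul h, unsignedIntegrand_eq,
    mul_assoc, mul_inv_cancel_left₀ hc]

theorem eq_smul_comm {ε : ℤˣ} {x y : OrientedGr24} (h : x = ε • y) : y = ε • x := by
  rw [h, ← mul_smul, Int.units_mul_self, one_smul]

/-! ### Dependence on the frame -/

theorem exists_diagonal_of_rowPoint_eq {A B : M24} (h : ∀ i, rowPoint A i = rowPoint B i) :
    ∃ a : Fin 2 → ℝ, B.1 = Matrix.diagonal a * A.1 := by
  have h' : ∀ i, ∃ a : ℝ, a • A.1 i = B.1 i := fun i =>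
    (Projectivization.mk_eq_mk_iff' ℝ _ _ (row_ne_zero B i) (row_ne_zero A i)).1 (h i).symm
  choose a ha using h'
  refine ⟨a, ?_⟩
  ext i j
  rw [← ha i, Matrix.diagonal_mul]
  rfl

/-- This is the scale invariance of `ds/s dt/t`: rescaling `W₂` and `W₃` leaves the kernel
unchanged, so only an orientation sign can remain. -/
theorem rationalKernel_diagonal {a : Fin 2 → ℝ} (ha : (Matrix.diagonal a).det ≠ 0) (x : ℝ × ℝ) :
    rationalKernel (Matrix.diagonal a) x = 1 / (x.1 * x.2) := by
  have ha' : a 0 * a 1 ≠ 0 := by simpa [Matrix.det_diagonal] using ha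
  have h : rationalKernel (Matrix.diagonal a) x = (a 0 * a 1) / ((a 0 * a 1) * (x.1 * x.2)) := by
    simp only [rationalKernel, Matrix.diagonal_apply_eq,
      Matrix.diagonal_apply_ne a (show (0 : Fin 2) ≠ 1 by decide),
      Matrix.diagonal_apply_ne a (show (1 : Fin 2) ≠ 0 by decide)]
    congr 1 <;> ring
  rw [h, ← div_div, div_self ha']

theorem delta_eq_of_rowPoint_eq {A B : M24} (h : ∀ i, rowPoint A i = rowPoint B i)
    (φ : Twistor → ℝ) : delta B φ = delta A φ := by
  obtain ⟨a, ha⟩ := exists_diagonal_of_rowPoint_eq h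
  rw [delta_eq_integral_kernel ha]
  refine integral_congr_ae (.of_forall fun p => ?_)
  simp only
  rw [rationalKernel_diagonal (det_ne_zero_of_eq_mul ha), signedIntegrand_eq]

theorem deltaTilde_eq_of_rowPoint_eq {A B : M24} {ε : ℤˣ}
    (h : ∀ i, rowPoint A i = rowPoint B i) (hε : orientedPlane B = ε • orientedPlane A)
    (φ : Twistor → ℝ) : deltaTilde B φ = ((ε : ℤ) : ℝ) * deltaTilde A φ := by
  obtain ⟨a, ha⟩ := exists_diagonal_of_rowPoint_eq h
  rw [deltaTilde_eq_integral_kernel ha ((orientedPlane_eq_smul_iff ha ε).1 hε)]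
  congr 1
  refine integral_congr_ae (.of_forall fun p => ?_)
  simp only
  rw [rationalKernel_diagonal (det_ne_zero_of_eq_mul ha), unsignedIntegrand_eq]

/-- The two projective points already determine the value, so `D` evaluates at any frame through
them; the value `0` is a default when there is none. -/
theorem exists_delta_over_Gr :
    ∃ D : Gr24 → Projectivization ℝ Twistor → Projectivization ℝ Twistor → (Twistor → ℝ) → ℝ,
      ∀ (B : M24) (φ : Twistor → ℝ),
        delta B φ = D (rowPlane B) (rowPoint B 0) (rowPoint B 1) φ := by
  classical
  refine ⟨fun _ p q φ => if h : ∃ B : M24, rowPoint B 0 = p ∧ rowPoint B 1 = q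
    then delta h.choose φ else 0, fun B φ => ?_⟩
  have h : ∃ A : M24, rowPoint A 0 = rowPoint B 0 ∧ rowPoint A 1 = rowPoint B 1 := ⟨B, rfl, rfl⟩
  simp only
  rw [dif_pos h]
  exact delta_eq_of_rowPoint_eq (Fin.forall_fin_two.2 h.choose_spec) φ

theorem rowPoint_frameMul_signMatrix (ε : ℤˣ) (B : M24) (i : Fin 2) :
    rowPoint (frameMul (signMatrix ε) (isUnit_det_signMatrix ε) B) i = rowPoint B i := by
  refine (Projectivization.mk_eq_mk_iff' ℝ _ _ _ _).2 ⟨![((ε : ℤ) : ℝ), 1] i, ?_⟩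
  ext j
  simp [frameMul, signMatrix]

theorem exists_deltaTilde_over_orientedGr :
    ∃ D : OrientedGr24 → Projectivization ℝ Twistor → Projectivization ℝ Twistor →
        (Twistor → ℝ) → ℝ,
      (∀ (B : M24) (φ : Twistor → ℝ),
        deltaTilde B φ = D (orientedPlane B) (rowPoint B 0) (rowPoint B 1) φ) ∧
      ∀ (ε : ℤˣ) (x : OrientedGr24) (p q : Projectivization ℝ Twistor) (φ : Twistor → ℝ),
        D (ε • x) p q φ = ((ε : ℤ) : ℝ) * D x p q φ := by
  classical
  let R : OrientedGr24 → Projectivization ℝ Twistor → Projectivization ℝ Twistor → M24 → Prop :=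
    fun x p q B => orientedPlane B = x ∧ rowPoint B 0 = p ∧ rowPoint B 1 = q
  let D : OrientedGr24 → Projectivization ℝ Twistor → Projectivization ℝ Twistor →
      (Twistor → ℝ) → ℝ := fun x p q φ =>
    if h : ∃ B, R x p q B then deltaTilde h.choose φ else 0
  have hD : ∀ (B : M24) (φ : Twistor → ℝ),
      deltaTilde B φ = D (orientedPlane B) (rowPoint B 0) (rowPoint B 1) φ := fun B φ => by
    have h : ∃ A, R (orientedPlane B) (rowPoint B 0) (rowPoint B 1) A := ⟨B, rfl, rfl, rfl⟩
    simp only [D]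
    rw [dif_pos h, deltaTilde_eq_of_rowPoint_eq (ε := 1) (A := h.choose)
      (Fin.forall_fin_two.2 h.choose_spec.2) (by rw [one_smul]; exact h.choose_spec.1.symm)]
    simp
  -- Flipping a row fixes both projective points, so frames exist over `x` and over `ε • x`
  -- together; oddness thus holds for the default value `0` as well.
  have hflip : ∀ (ε : ℤˣ) {x p q}, (∃ B, R x p q B) → ∃ B, R (ε • x) p q B := by
    rintro ε x p q ⟨B, rfl, rfl, rfl⟩
    exact ⟨frameMul (signMatrix ε) (isUnit_det_signMatrix ε) B, rfl,
      rowPoint_frameMul_signMatrix ε B 0, rowPoint_frameMul_signMatrix ε B 1⟩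
  refine ⟨D, hD, fun ε x p q φ => ?_⟩
  by_cases h : ∃ B, R x p q B
  · obtain ⟨B, rfl, rfl, rfl⟩ := h
    have hr := rowPoint_frameMul_signMatrix ε B
    rw [← hD, ← deltaTilde_eq_of_rowPoint_eq (fun i => (hr i).symm)
      (smul_orientedPlane ε B).symm, hD, hr, hr]
    rfl
  · have h' : ¬ ∃ B, R (ε • x) p q B := fun hB => h (by
      have := hflip ε hB
      rwa [← mul_smul, Int.units_mul_self, one_smul] at this)
    simp only [D]
    rw [dif_neg h, dif_neg h', mul_zero]

/-! ### The unsigned delta function is not defined over the Grassmannian -/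

/-- The frame of the first two coordinate vectors. -/
def coordFrame : M24 :=
  ⟨rows ![1, 0, 0, 0] ![0, 1, 0, 0], by
    rw [linearIndependent_rows_iff]
    intro s t h
    exact ⟨by simpa using congrFun h 0, by simpa using congrFun h 1⟩⟩

theorem planePoint_coordFrame (p : ℝ × ℝ) : planePoint coordFrame p = ![p.1, p.2, 0, 0] := by
  ext j
  fin_cases j <;> simp [planePoint, coordFrame, rows]

theorem pos_mem_admissible_coordFrame {W : Twistor} (h : 0 < W 0 ∧ 0 < W 1) :
    W ∈ admissible coordFrame := by
  constructor
  · rw [linearIndependent_rows_iff]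
    intro s t hst
    have h0 := congrFun hst 0
    have h1 := congrFun hst 1
    simp [coordFrame, rows, h.1.ne'] at h0 h1
    subst h0
    simpa using h1
  · rw [linearIndependent_rows_iff]
    intro s t hst
    have h0 := congrFun hst 0
    have h1 := congrFun hst 1
    simp [coordFrame, rows, h.2.ne'] at h0 h1
    subst h1
    simpa using h0

theorem exists_test_deltaTilde_ne_zero :
    ∃ φ : Twistor → ℝ, IsTest coordFrame φ ∧ deltaTilde coordFrame φ ≠ 0 := by
  have hopen : IsOpen {W : Twistor | 0 < W 0 ∧ 0 < W 1} :=
    (isOpen_lt continuous_const (continuous_apply 0)).inter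
      (isOpen_lt continuous_const (continuous_apply 1))
  have hmem : (![1, 1, 0, 0] : Twistor) ∈ {W : Twistor | 0 < W 0 ∧ 0 < W 1} := by simp
  obtain ⟨φ, hsupp, hcomp, hsmooth, hrange, hone⟩ :=
    exists_contDiff_tsupport_subset (n := ⊤) (hopen.mem_nhds hmem)
  have hφ : IsTest coordFrame φ :=
    ⟨hsmooth, hcomp, fun W hW => pos_mem_admissible_coordFrame (hsupp hW)⟩
  -- A bump supported in the open quadrant `s, t > 0` gives a continuous nonnegative integrand with
  -- value `1` at `(1, 1)`, so nothing cancels.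
  refine ⟨φ, hφ, (hφ.continuous_unsignedIntegrand.integral_pos_of_hasCompactSupport_nonneg_nonzero
    hφ.hasCompactSupport_unsignedIntegrand (x := (1, 1)) (fun p => ?_) ?_).ne'⟩
  · rw [unsignedIntegrand_eq]
    by_cases hp : φ (planePoint coordFrame p) = 0
    · simp [hp]
    · have hpos := hsupp (subset_tsupport _ hp)
      rw [planePoint_coordFrame] at hpos
      have h1 : 0 < p.1 := hpos.1
      have h2 : 0 < p.2 := hpos.2
      exact mul_nonneg (by positivity) (hrange ⟨_, rfl⟩).1
  · rw [unsignedIntegrand_eq, planePoint_coordFrame, hone]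
    norm_num

/-- Admissibility does not see the scale of a row, so one `φ` tests both a frame and its flip. -/
theorem IsTest.frameMul_signMatrix {B : M24} {φ : Twistor → ℝ} (h : IsTest B φ) (ε : ℤˣ) :
    IsTest (frameMul (signMatrix ε) (isUnit_det_signMatrix ε) B) φ := by
  refine ⟨h.smooth, h.compact, h.supported.trans fun W hW => ?_⟩
  have hε : ((ε : ℤ) : ℝ) ≠ 0 := fun h0 => by simpa [h0] using unit_cast_sq ε
  have h0 : (CollinearDelta.frameMul (signMatrix ε) (isUnit_det_signMatrix ε) B).1 0 =
      ((ε : ℤ) : ℝ) • B.1 0 := by ext j; simp [CollinearDelta.frameMul, signMatrix]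
  have h1 : (CollinearDelta.frameMul (signMatrix ε) (isUnit_det_signMatrix ε) B).1 1 = B.1 1 := by
    ext j; simp [CollinearDelta.frameMul, signMatrix]
  refine ⟨by rw [h1]; exact hW.1, ?_⟩
  rw [h0, linearIndependent_rows_iff]
  intro s t hst
  rw [smul_smul] at hst
  have := (linearIndependent_rows_iff _ _).1 hW.2 _ _ hst
  exact ⟨this.1, (mul_eq_zero.1 this.2).resolve_right hε⟩

/-- Negating one row preserves the plane and both projective points but negates the pairing, which
would have to vanish identically. -/
theorem not_exists_deltaTilde_over_Gr :
    ¬ ∃ D : Gr24 → Projectivization ℝ Twistor → Projectivization ℝ Twistor → (Twistor → ℝ) → ℝ,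
      ∀ (B : M24) (φ : Twistor → ℝ), IsTest B φ →
        deltaTilde B φ = D (rowPlane B) (rowPoint B 0) (rowPoint B 1) φ := by
  rintro ⟨D, hD⟩
  obtain ⟨φ, hφ, hne⟩ := exists_test_deltaTilde_ne_zero
  have hr := rowPoint_frameMul_signMatrix (-1) coordFrame
  have h1 := hD _ φ (hφ.frameMul_signMatrix (-1))
  rw [rowPlane_frameMul, hr, hr, ← hD _ φ hφ, deltaTilde_eq_of_rowPoint_eq
    (fun i => (hr i).symm) (smul_orientedPlane (-1) coordFrame).symm] at h1
  apply hne
  simp at h1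
  linarith

end CollinearDelta

end

theorem mainTheorem2 :
    -- both delta functions are given by convergent integrals
    (∀ (B : CollinearDelta.M24) (φ : CollinearDelta.Twistor → ℝ), CollinearDelta.IsTest B φ →
      MeasureTheory.Integrable (CollinearDelta.signedIntegrand B φ) ∧
      MeasureTheory.Integrable (CollinearDelta.unsignedIntegrand B φ)) ∧
    -- the signed one is `sgn(⟨31⟩⟨12⟩)` times the unsigned one where `⟨23⟩ ≠ 0`
    (∀ (B : CollinearDelta.M24) (φ : CollinearDelta.Twistor → ℝ), CollinearDelta.IsTest B φ →
      CollinearDelta.bracket (B.1 0) (B.1 1) ≠ 0 →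
      CollinearDelta.delta B φ = CollinearDelta.deltaTilde B (fun W =>
        Real.sign (CollinearDelta.bracket (B.1 1) W * CollinearDelta.bracket W (B.1 0)) * φ W)) ∧
    -- both vanish away from the configurations whose frames give one point of the Grassmannian
    (∀ (B : CollinearDelta.M24) (φ : CollinearDelta.Twistor → ℝ), CollinearDelta.IsTest B φ →
      (∀ W : CollinearDelta.admissible B,
        CollinearDelta.rowPlane (CollinearDelta.frame31 B W) = CollinearDelta.rowPlane B →
        CollinearDelta.rowPlane (CollinearDelta.frame12 B W) = CollinearDelta.rowPlane B →
        φ W = 0) →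
      CollinearDelta.delta B φ = 0 ∧ CollinearDelta.deltaTilde B φ = 0) ∧
    -- they agree up to the sign `ε` where the two frames differ by `ε ∈ O(1)` in
    -- `M_{2,4} / (ℝ⁺ × SL₂)`; in particular they agree where the frames give the same point
    (∀ (B : CollinearDelta.M24) (φ : CollinearDelta.Twistor → ℝ) (ε : ℤˣ),
      CollinearDelta.IsTest B φ →
      (∀ W : CollinearDelta.admissible B,
        CollinearDelta.rowPlane (CollinearDelta.frame31 B W) =
          CollinearDelta.rowPlane (CollinearDelta.frame12 B W) →
        CollinearDelta.orientedPlane (CollinearDelta.frame31 B W) ≠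
          ε • CollinearDelta.orientedPlane (CollinearDelta.frame12 B W) →
        φ W = 0) →
      CollinearDelta.deltaTilde B φ = ((ε : ℤ) : ℝ) * CollinearDelta.delta B φ) ∧
    -- the signed one, in an arbitrary frame of the plane
    (∀ (A B : CollinearDelta.M24) (c : Matrix (Fin 2) (Fin 2) ℝ) (φ : CollinearDelta.Twistor → ℝ),
      CollinearDelta.IsTest B φ → B.1 = c * A.1 →
      CollinearDelta.delta B φ =
        ∫ x : ℝ × ℝ, |CollinearDelta.rationalKernel c x| * φ (CollinearDelta.planePoint A x)) ∧
    -- the unsigned one, in an arbitrary frame `A` of the plane; the sign is the position of `A` in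
    -- `M_{2,4} / (ℝ⁺ × SL₂)` relative to `(W₂; W₃)`
    (∀ (A B : CollinearDelta.M24) (c : Matrix (Fin 2) (Fin 2) ℝ) (φ : CollinearDelta.Twistor → ℝ)
      (ε : ℤˣ),
      CollinearDelta.IsTest B φ → B.1 = c * A.1 →
      CollinearDelta.orientedPlane A = ε • CollinearDelta.orientedPlane B →
      CollinearDelta.deltaTilde B φ = ((ε : ℤ) : ℝ) *
        ∫ x : ℝ × ℝ, CollinearDelta.rationalKernel c x * φ (CollinearDelta.planePoint A x)) ∧
    -- as a function of projective twistors, the signed one is defined over the Grassmannian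
    (∃ D : CollinearDelta.Gr24 → Projectivization ℝ CollinearDelta.Twistor →
        Projectivization ℝ CollinearDelta.Twistor → (CollinearDelta.Twistor → ℝ) → ℝ,
      ∀ (B : CollinearDelta.M24) (φ : CollinearDelta.Twistor → ℝ), CollinearDelta.IsTest B φ →
        CollinearDelta.delta B φ = D (CollinearDelta.rowPlane B)
          (CollinearDelta.rowPoint B 0) (CollinearDelta.rowPoint B 1) φ) ∧
    -- the unsigned one is defined over `M_{2,4} / (ℝ⁺ × SL₂)` and is odd under `O(1)`
    (∃ D : CollinearDelta.OrientedGr24 → Projectivization ℝ CollinearDelta.Twistor →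
        Projectivization ℝ CollinearDelta.Twistor → (CollinearDelta.Twistor → ℝ) → ℝ,
      (∀ (B : CollinearDelta.M24) (φ : CollinearDelta.Twistor → ℝ), CollinearDelta.IsTest B φ →
        CollinearDelta.deltaTilde B φ = D (CollinearDelta.orientedPlane B)
          (CollinearDelta.rowPoint B 0) (CollinearDelta.rowPoint B 1) φ) ∧
      ∀ (ε : ℤˣ) (x : CollinearDelta.OrientedGr24)
        (p q : Projectivization ℝ CollinearDelta.Twistor) (φ : CollinearDelta.Twistor → ℝ),
        D (ε • x) p q φ = ((ε : ℤ) : ℝ) * D x p q φ) ∧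
    -- the unsigned one is not defined over the Grassmannian
    (¬ ∃ D : CollinearDelta.Gr24 → Projectivization ℝ CollinearDelta.Twistor →
        Projectivization ℝ CollinearDelta.Twistor → (CollinearDelta.Twistor → ℝ) → ℝ,
      ∀ (B : CollinearDelta.M24) (φ : CollinearDelta.Twistor → ℝ), CollinearDelta.IsTest B φ →
        CollinearDelta.deltaTilde B φ = D (CollinearDelta.rowPlane B)
          (CollinearDelta.rowPoint B 0) (CollinearDelta.rowPoint B 1) φ) ∧
    -- `M_{2,4} / GL₂` is the Grassmannian
    (∃ e : CollinearDelta.FrameModGL ≃ₜ CollinearDelta.Gr24, ∀ B : CollinearDelta.M24,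
      e (Quotient.mk CollinearDelta.glSetoid B) = CollinearDelta.rowPlane B) ∧
    -- `O(1)` acts freely and continuously on `M_{2,4} / (ℝ⁺ × SL₂)`, and the quotient is the
    -- Grassmannian
    (∀ (ε : ℤˣ) (x : CollinearDelta.OrientedGr24), ε • x = x → ε = 1) ∧
    (∀ ε : ℤˣ, Continuous (fun x : CollinearDelta.OrientedGr24 => ε • x)) ∧
    (∃ e : MulAction.orbitRel.Quotient ℤˣ CollinearDelta.OrientedGr24 ≃ₜ CollinearDelta.Gr24,
      ∀ B : CollinearDelta.M24,
        e (Quotient.mk _ (CollinearDelta.orientedPlane B)) = CollinearDelta.rowPlane B) ∧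
    -- `M_{2,4} / (ℝ⁺ × SL₂)` is identified with `Gr × O(1)` over the Grassmannian, compatibly with
    -- `O(1)`; over the open set where a chosen minor is nonzero the identification is the sign of
    -- that minor, and it is a homeomorphism there
    (∀ i j : Fin 4, i ≠ j →
      ∃ e : CollinearDelta.OrientedGr24 ≃ CollinearDelta.Gr24 × ℤˣ,
        (∀ B : CollinearDelta.M24,
          (e (CollinearDelta.orientedPlane B)).1 = CollinearDelta.rowPlane B) ∧
        (∀ (ε : ℤˣ) (x : CollinearDelta.OrientedGr24), e (ε • x) = ((e x).1, ε * (e x).2)) ∧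
        (∀ B : CollinearDelta.M24, CollinearDelta.minor B i j ≠ 0 →
          (((e (CollinearDelta.orientedPlane B)).2 : ℤ) : ℝ) =
            Real.sign (CollinearDelta.minor B i j)) ∧
        IsOpen (CollinearDelta.orientedPlane '' {B | CollinearDelta.minor B i j ≠ 0}) ∧
        IsOpen (CollinearDelta.rowPlane '' {B | CollinearDelta.minor B i j ≠ 0}) ∧
        ContinuousOn e (CollinearDelta.orientedPlane '' {B | CollinearDelta.minor B i j ≠ 0}) ∧
        ContinuousOn e.symm
          ((CollinearDelta.rowPlane '' {B | CollinearDelta.minor B i j ≠ 0}) ×ˢ Set.univ)) := by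
  open CollinearDelta in
  exact ⟨fun B φ h => h.integrable,
    fun B φ _ h => delta_eq_deltaTilde_sign B φ h,
    fun B φ hφ h => delta_eq_zero_of_vanish hφ h,
    fun B φ ε hφ h => deltaTilde_eq_mul_delta hφ h,
    fun A B c φ _ h => delta_eq_integral_kernel h φ,
    fun A B c φ ε _ h hε =>
      deltaTilde_eq_integral_kernel h ((orientedPlane_eq_smul_iff h ε).1 (eq_smul_comm hε)) φ,
    exists_delta_over_Gr.imp fun D h B φ _ => h B φ,
    exists_deltaTilde_over_orientedGr.imp fun D h => ⟨fun B φ _ => h.1 B φ, h.2⟩,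
    not_exists_deltaTilde_over_Gr,
    exists_homeomorph_frameModGL,
    fun _ _ => smul_orientedGr_eq_self,
    continuous_smul_orientedGr,
    exists_homeomorph_orbitQuotient,
    fun i j _ => exists_trivialization i j⟩
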